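/- All graphs are finite and simple. A mixed graph $\widetilde G$ is obtained from a graph $G$ (its underlying graph) by assigning directions to some of the edges of $G$. Its Hermitian adjacency matrix $H(\widetilde G)=(h_{uv})$ has $h_{uv}=1$ if $uv$ is an undirected edge, $h_{uv}=i$ if there is an arc from $u$ to $v$, $h_{uv}=-i$ if there is an arc from $v$ to $u$, and $h_{uv}=0$ otherwise; $\widetilde G$ is nonsingular if $\det H(\widetilde G)\neq 0$. For a cycle $C$ of $G$, the signature $\sigma(\widetilde C)$ is $|f-b|$, where, for a chosen direction of traversal of $C$, $f$ and $b$ are the numbers of edges of $C$ that are directed forward and backward, respectively (undirected edges are not counted). A fractional matching of $G$ is a function $f:E(G)\to[0,1]$ such that, for every vertex $v$, the values of $f$ on the edges incident to $v$ add up to at most $1$. The maximum of $\sum_{e\in E(G)}f(e)$ over all fractional matchings is denoted $m^*(G)$. A fractional perfect matching is a fractional matching with $\sum_{e\in E(G)}f(e)=|V(G)|/2$. Let $\mathcal F$ be the set of fractional matchings $f$ of $G$ with $\sum_{e\in E(G)}f(e)=m^*(G)$ and $f(e)\in\{0,\tfrac12,1\}$ for every edge $e$. An optimal fractional matching is an $f\in\mathcal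 F$ for which the number of edges $e$ with $f(e)=1$ is the largest possible within $\mathcal F$. **Theorem 1.5.** Let $\widetilde G$ be a mixed graph whose underlying graph $G$ is bipartite and in which any two distinct cycles are vertex-disjoint. Then $\widetilde G$ is nonsingular if and only if the following two conditions both hold: (a) $G$ has a fractional perfect matching; (b) there exists an optimal fractional matching $f$ of $G$ such that, for every even cycle $C_q$ of $G$ (of length $q$) with $\sigma(\widetilde C_q)\equiv q \pmod 4$, there is an edge $e$ of $G$ with one endpoint in $V(C_q)$ and the other outside $V(C_q)$ such that $f(e)=1$. -/

import Mathlib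

namespace SimpleGraph

variable {V : Type*}

/-- The distinct cycles of `G` (as subgraphs) are pairwise vertex-disjoint. -/
def CyclesVertexDisjoint (G : SimpleGraph V) : Prop :=
  ∀ ⦃u v : V⦄ (c : G.Walk u u) (d : G.Walk v v), c.IsCycle → d.IsCycle →
    c.toSubgraph ≠ d.toSubgraph → ∀ x : V, x ∈ c.support → x ∉ d.support

/-- The edges of `G` with one endpoint in `S` and the other endpoint outside `S`. -/
def edgesLeaving (G : SimpleGraph V) (S : Set V) : Set G.edgeSet :=
  {e | (∃ x ∈ (e : Sym2 V), x ∈ S) ∧ ∃ y ∈ (e : Sym2 V), y ∉ S}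

variable [Fintype V]

open Classical in
/-- The total weight of a weighting of the edges. -/
noncomputable def totalWeight (G : SimpleGraph V) (f : G.edgeSet → ℝ) : ℝ :=
  ∑ e : G.edgeSet, f e

open Classical in
/-- The sum of the weights of the edges incident to `v`. -/
noncomputable def weightAt (G : SimpleGraph V) (f : G.edgeSet → ℝ) (v : V) : ℝ :=
  ∑ e ∈ Finset.univ.filter (fun e : G.edgeSet => v ∈ (e : Sym2 V)), f e

/-- A fractional matching: edge weights in `[0, 1]` with sum at most `1` around each vertex. -/
def IsFractionalMatching (G : SimpleGraph V) (f : G.edgeSet → ℝ) : Prop :=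
  (∀ e, f e ∈ Set.Icc (0 : ℝ) 1) ∧ ∀ v, G.weightAt f v ≤ 1

/-- The fractional matching number. The set is nonempty, bounded and compact, so this supremum
is a maximum. -/
noncomputable def fractionalMatchingNumber (G : SimpleGraph V) : ℝ :=
  sSup {t | ∃ f : G.edgeSet → ℝ, G.IsFractionalMatching f ∧ t = G.totalWeight f}

/-- A fractional perfect matching: a fractional matching of total weight `|V| / 2`. -/
def IsFractionalPerfectMatching (G : SimpleGraph V) (f : G.edgeSet → ℝ) : Prop :=
  G.IsFractionalMatching f ∧ G.totalWeight f = (Fintype.card V : ℝ) / 2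

/-- The fractional matchings of maximum total weight with all weights in `{0, 1/2, 1}`. -/
def maxHalfIntegralMatchings (G : SimpleGraph V) : Set (G.edgeSet → ℝ) :=
  {f | G.IsFractionalMatching f ∧ G.totalWeight f = G.fractionalMatchingNumber ∧
    ∀ e, f e = 0 ∨ f e = 1 / 2 ∨ f e = 1}

/-- An optimal fractional matching: a maximum fractional matching with weights in `{0, 1/2, 1}`
having, among all of these, the largest number of edges of weight `1`. -/
def IsOptimalFractionalMatching (G : SimpleGraph V) (f : G.edgeSet → ℝ) : Prop :=
  f ∈ G.maxHalfIntegralMatchings ∧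
    ∀ g ∈ G.maxHalfIntegralMatchings, {e | g e = 1}.ncard ≤ {e | f e = 1}.ncard

end SimpleGraph

/-- A mixed graph: a simple graph some of whose edges have been given a direction.
`Arc u v` says that the edge `uv` is directed from `u` to `v`. -/
structure MixedGraph (V : Type*) where
  graph : SimpleGraph V
  Arc : V → V → Prop
  adj_of_arc : ∀ u v, Arc u v → graph.Adj u v
  not_arc_of_arc : ∀ u v, Arc u v → ¬ Arc v u

namespace MixedGraph

variable {V : Type*}

open Classical in
/-- The Hermitian adjacency matrix. -/
noncomputable def hermitianAdjMatrix (M : MixedGraph V) : Matrix V V ℂ :=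
  Matrix.of fun u v =>
    if M.Arc u v then Complex.I
    else if M.Arc v u then -Complex.I
    else if M.graph.Adj u v then 1
    else 0

/-- A mixed graph is nonsingular when its Hermitian adjacency matrix is. -/
def Nonsingular [Fintype V] [DecidableEq V] (M : MixedGraph V) : Prop :=
  M.hermitianAdjMatrix.det ≠ 0

open Classical in
/-- The signature `|f - b|` of a closed walk tracing a cycle: `f` edges are directed along the
walk and `b` edges against it. Another starting point or the reverse traversal of the same cycle
gives the same value. -/
noncomputable def signature (M : MixedGraph V) {u : V} (c : M.graph.Walk u u) : ℕ :=
  ((c.darts.countP fun d => M.Arc d.fst d.snd : ℤ) -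
    (c.darts.countP fun d => M.Arc d.snd d.fst : ℤ)).natAbs

end MixedGraph

/-! ### Perfect matchings from fractional ones. -/

namespace SimpleGraph

variable {V : Type*} {G : SimpleGraph V}

/-! In a bipartite graph a fractional perfect matching, or a nonzero term of the determinant, yields
a permutation along edges and hence a perfect matching, encoded as an involution `μ`. Optimal
fractional matchings are then indicators of perfect matchings. Call a cycle bad if it is even with
signature congruent to its length q mod 4; equivalently, the product of the matrix entries along it
is `I ^ q`. What remains is to show, for a fixed `μ`, that the determinant vanishes iff some bad
cycle is closed under `μ`.

If such a cycle exists (`det_eq_zero_of_cycle`), disjointness of cycles forces every permutation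
along edges to preserve its vertex set. So the entries between the cycle and the rest can be zeroed
without changing the determinant, and the cycle block has an explicit kernel vector.

Conversely (`exists_cycle_of_det_eq_zero`), take a nonzero kernel vector `x`. Row `a` with `x (μ a)
≠ 0` has another nonzero term, at some `μ b`; draw an arrow from `a` to `b`. In a terminal class
each arrow lies on a closed walk, hence on a cycle of the graph, and disjointness leaves one arrow
per vertex. Following the arrows gives a `μ`-closed cycle, and the two-term row equations compute
its weight. -/

theorem IsBipartite.exists_involutive (hG : G.IsBipartite) {π : Equiv.Perm V}
    (hπ : ∀ v, G.Adj v (π v)) :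
    ∃ μ : V → V, Function.Involutive μ ∧ ∀ v, G.Adj v (μ v) := by
  obtain ⟨C⟩ := hG
  have h1 : ∀ v, C v = 0 → C (π v) ≠ 0 := fun v hv h => C.valid (hπ v) (hv.trans h.symm)
  have h2 : ∀ v, C v ≠ 0 → C (π.symm v) = 0 := by
    intro v hv
    have := C.valid (hπ (π.symm v))
    rw [Equiv.apply_symm_apply] at this
    omega
  -- Only the part of `π` leaving colour class 0 is kept; its inverse serves the other class.
  refine ⟨fun v => if C v = 0 then π v else π.symm v, fun v => ?_, fun v => ?_⟩
  · by_cases hv : C v = 0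
    · simp [hv, h1 v hv]
    · simp [hv, h2 v hv]
  · by_cases hv : C v = 0
    · simpa [hv] using hπ v
    · simpa [hv] using (hπ (π.symm v)).symm

variable [Fintype V]

theorem sum_weightAt (f : G.edgeSet → ℝ) : ∑ v, G.weightAt f v = 2 * G.totalWeight f := by
  classical
  unfold weightAt totalWeight
  simp_rw [Finset.sum_filter]
  rw [Finset.sum_comm, Finset.mul_sum]
  refine Finset.sum_congr rfl fun e _ => ?_
  obtain ⟨e, he⟩ := e
  induction e using Sym2.ind with
  | _ x y =>
    have hxy : x ≠ y := (G.mem_edgeSet.1 he).ne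
    rw [← Finset.sum_filter]
    have : (Finset.univ.filter fun v => v ∈ s(x, y)) = {x, y} := by
      ext v; simp
    simp only [this]
    rw [Finset.sum_pair hxy]
    ring

theorem IsFractionalMatching.totalWeight_le {f : G.edgeSet → ℝ} (hf : G.IsFractionalMatching f) :
    G.totalWeight f ≤ (Fintype.card V : ℝ) / 2 := by
  have h := Finset.sum_le_sum fun v (_ : v ∈ (Finset.univ : Finset V)) => hf.2 v
  rw [sum_weightAt] at h
  simp at h
  linarith

theorem IsFractionalPerfectMatching.weightAt_eq_one {f : G.edgeSet → ℝ}
    (hf : G.IsFractionalPerfectMatching f) (v : V) : G.weightAt f v = 1 := by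
  have h := sum_weightAt f
  rw [hf.2] at h
  have h2 : ∑ v : V, (1 - G.weightAt f v) = 0 := by
    rw [Finset.sum_sub_distrib, h]; simp; ring
  have h3 := (Finset.sum_eq_zero_iff_of_nonneg (fun v _ => sub_nonneg.2 (hf.1.2 v))).1 h2 v
    (Finset.mem_univ v)
  linarith

theorem IsFractionalPerfectMatching.fractionalMatchingNumber_eq {f : G.edgeSet → ℝ}
    (hf : G.IsFractionalPerfectMatching f) :
    G.fractionalMatchingNumber = (Fintype.card V : ℝ) / 2 := by
  refine IsGreatest.csSup_eq ⟨⟨f, hf.1, hf.2.symm⟩, ?_⟩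
  rintro t ⟨g, hg, rfl⟩
  exact hg.totalWeight_le

/-- Hall's theorem turns a fractional perfect matching into a permutation along edges. -/
theorem IsFractionalPerfectMatching.exists_perm {f : G.edgeSet → ℝ}
    (hf : G.IsFractionalPerfectMatching f) : ∃ π : Equiv.Perm V, ∀ v, G.Adj v (π v) := by
  classical
  have key : ∀ s : Finset V, s.card ≤ (s.biUnion fun v => G.neighborFinset v).card := by
    intro s
    set N := s.biUnion fun v => G.neighborFinset v
    have h1 : ∑ v ∈ s, G.weightAt f v ≤ ∑ v ∈ N, G.weightAt f v := by
      unfold weightAt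
      simp_rw [Finset.sum_filter]
      rw [Finset.sum_comm, Finset.sum_comm (s := N)]
      refine Finset.sum_le_sum fun e _ => ?_
      rw [← Finset.sum_filter, ← Finset.sum_filter, Finset.sum_const, Finset.sum_const]
      refine nsmul_le_nsmul_left (hf.1.1 e).1 ?_
      obtain ⟨e, he⟩ := e
      have hcard : ∀ v ∈ e, ∃ w ∈ e, G.Adj v w := by
        intro v hv
        obtain ⟨w, rfl⟩ := hv
        exact ⟨w, Sym2.mem_mk_right _ _, he⟩
      induction e using Sym2.ind with
      | _ x y =>
        have hxy : G.Adj x y := he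
        -- Swapping the ends of the edge carries ends in `s` to ends in `N`, so each edge
        -- contributes at least as much to `N`.
        refine Finset.card_le_card_of_injOn (fun v => if v = x then y else x) ?_ ?_
        · intro v hv
          simp only [Finset.coe_filter, Set.mem_ofPred_eq, Sym2.mem_iff] at hv ⊢
          rcases hv.2 with h | h
          · subst h
            exact ⟨by simpa [N] using ⟨v, hv.1, hxy⟩, by simp⟩
          · subst h
            rw [if_neg hxy.ne']
            exact ⟨by simpa [N] using ⟨v, hv.1, hxy.symm⟩, by simp⟩
        · intro v hv w hw h
          have := hxy.ne
          simp only [Finset.coe_filter, Set.mem_ofPred_eq, Sym2.mem_iff] at hv hw h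
          split_ifs at h <;> grind
    simp only [hf.weightAt_eq_one, Finset.sum_const, nsmul_eq_mul, mul_one] at h1
    exact_mod_cast h1
  obtain ⟨g, hg, hg'⟩ := (Finset.all_card_le_biUnion_card_iff_exists_injective _).1 key
  exact ⟨Equiv.ofBijective g (Finite.injective_iff_bijective.1 hg), fun v => by
    simpa using hg' v⟩

open Classical in
/-- The indicator of the perfect matching given by an involution along edges. -/
noncomputable def matchingWeight (G : SimpleGraph V) (μ : V → V) (e : G.edgeSet) : ℝ :=
  if ∃ v, (e : Sym2 V) = s(v, μ v) then 1 else 0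

section matchingWeight

variable {μ : V → V}

theorem matchingWeight_eq_one_iff {e : G.edgeSet} :
    G.matchingWeight μ e = 1 ↔ ∃ v, (e : Sym2 V) = s(v, μ v) := by
  unfold matchingWeight
  split_ifs with h <;> simp [h]

theorem matchingWeight_eq_zero_or_one (e : G.edgeSet) :
    G.matchingWeight μ e = 0 ∨ G.matchingWeight μ e = 1 := by
  unfold matchingWeight
  split_ifs <;> simp

theorem weightAt_matchingWeight (hμ : Function.Involutive μ) (hadj : ∀ v, G.Adj v (μ v)) (v : V) :
    G.weightAt (G.matchingWeight μ) v = 1 := by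
  classical
  unfold weightAt
  rw [Finset.sum_eq_single (⟨s(v, μ v), hadj v⟩ : G.edgeSet)]
  · exact matchingWeight_eq_one_iff.2 ⟨v, rfl⟩
  · intro e he hne
    refine (matchingWeight_eq_zero_or_one e).resolve_right fun h => hne ?_
    obtain ⟨w, hw⟩ := matchingWeight_eq_one_iff.1 h
    simp only [Finset.mem_filter, Finset.mem_univ, true_and, hw, Sym2.mem_iff] at he
    refine Subtype.ext ?_
    rcases he with rfl | rfl
    · exact hw
    · simp only [hw, hμ w, Sym2.eq_swap]
  · intro h; simp at h

theorem isFractionalPerfectMatching_matchingWeight (hμ : Function.Involutive μ)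
    (hadj : ∀ v, G.Adj v (μ v)) : G.IsFractionalPerfectMatching (G.matchingWeight μ) := by
  refine ⟨⟨fun e => ?_, fun v => (weightAt_matchingWeight hμ hadj v).le⟩, ?_⟩
  · rcases matchingWeight_eq_zero_or_one (μ := μ) e with h | h <;> simp [h]
  · have := sum_weightAt (G.matchingWeight μ)
    simp [weightAt_matchingWeight hμ hadj] at this
    linarith

/-- The equality case is what lets the tie-break by weight-1 edges single out 0/1-valued matchings.
-/
theorem ncard_le_totalWeight {f : G.edgeSet → ℝ} (hf : ∀ e, 0 ≤ f e) :
    ({e | f e = 1}.ncard : ℝ) ≤ G.totalWeight f ∧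
      (({e | f e = 1}.ncard : ℝ) = G.totalWeight f ↔ ∀ e, f e = 0 ∨ f e = 1) := by
  classical
  have h1 : ({e | f e = 1}.ncard : ℝ) = ∑ e, if f e = 1 then (1 : ℝ) else 0 := by
    rw [Finset.sum_boole, Set.ncard_eq_toFinset_card', Set.toFinset_ofPred]
  have h2 : ∀ e, (if f e = 1 then (1 : ℝ) else 0) ≤ f e := by
    intro e
    split_ifs with h
    · exact h.ge
    · exact hf e
  rw [h1, totalWeight]
  refine ⟨Finset.sum_le_sum fun e _ => h2 e, ?_⟩
  rw [Finset.sum_eq_sum_iff_of_le fun e _ => h2 e]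
  refine ⟨fun h e => ?_, fun h e _ => ?_⟩
  · have := h e (Finset.mem_univ e)
    split_ifs at this with h'
    · exact Or.inr h'
    · exact Or.inl this.symm
  · rcases h e with h | h <;> simp [h]

theorem matchingWeight_mem (hμ : Function.Involutive μ) (hadj : ∀ v, G.Adj v (μ v)) :
    G.matchingWeight μ ∈ G.maxHalfIntegralMatchings := by
  have h := isFractionalPerfectMatching_matchingWeight hμ hadj
  refine ⟨h.1, by rw [h.2, h.fractionalMatchingNumber_eq], fun e => ?_⟩
  rcases matchingWeight_eq_zero_or_one (μ := μ) e with h | h <;> simp [h]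

theorem ncard_matchingWeight (hμ : Function.Involutive μ) (hadj : ∀ v, G.Adj v (μ v)) :
    ({e | G.matchingWeight μ e = 1}.ncard : ℝ) = (Fintype.card V : ℝ) / 2 := by
  have h := isFractionalPerfectMatching_matchingWeight hμ hadj
  rw [(ncard_le_totalWeight fun e => (h.1.1 e).1).2.2 matchingWeight_eq_zero_or_one, h.2]

theorem isOptimalFractionalMatching_matchingWeight (hμ : Function.Involutive μ)
    (hadj : ∀ v, G.Adj v (μ v)) : G.IsOptimalFractionalMatching (G.matchingWeight μ) := by
  refine ⟨matchingWeight_mem hμ hadj, fun g hg => ?_⟩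
  have h1 := (ncard_le_totalWeight fun e => (hg.1.1 e).1).1.trans hg.1.totalWeight_le
  rw [← ncard_matchingWeight hμ hadj] at h1
  exact_mod_cast h1

/-- In a graph with a perfect matching, optimal fractional matchings are perfect matchings. -/
theorem IsOptimalFractionalMatching.exists_involutive (hμ : Function.Involutive μ)
    (hadj : ∀ v, G.Adj v (μ v)) {f : G.edgeSet → ℝ} (hf : G.IsOptimalFractionalMatching f) :
    ∃ ν : V → V, Function.Involutive ν ∧ (∀ v, G.Adj v (ν v)) ∧
      ∀ e, f e = 1 → ∀ v ∈ (e : Sym2 V), (e : Sym2 V) = s(v, ν v) := by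
  classical
  have hperf : G.IsFractionalPerfectMatching f :=
    ⟨hf.1.1, by rw [hf.1.2.1,
      (isFractionalPerfectMatching_matchingWeight hμ hadj).fractionalMatchingNumber_eq]⟩
  have hnn : ∀ e, 0 ≤ f e := fun e => (hf.1.1.1 e).1
  have h1 : ({e | f e = 1}.ncard : ℝ) = G.totalWeight f := by
    refine (ncard_le_totalWeight hnn).1.antisymm ?_
    rw [hperf.2, ← ncard_matchingWeight hμ hadj]
    exact_mod_cast hf.2 _ (matchingWeight_mem hμ hadj)
  have h01 := (ncard_le_totalWeight hnn).2.1 h1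
  have huniq : ∀ (e e' : G.edgeSet) v, f e = 1 → f e' = 1 → v ∈ (e : Sym2 V) →
      v ∈ (e' : Sym2 V) → e = e' := by
    intro e e' v he he' hv hv'
    by_contra hne
    have h2 := hperf.1.2 v
    have h3 : ∑ e ∈ {e, e'}, f e ≤ G.weightAt f v := by
      unfold weightAt
      refine Finset.sum_le_sum_of_subset_of_nonneg ?_ fun e _ _ => hnn e
      intro a ha
      simp only [Finset.mem_insert, Finset.mem_singleton] at ha
      rcases ha with rfl | rfl <;> simp [hv, hv']
    rw [Finset.sum_pair hne, he, he'] at h3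
    linarith
  have hex : ∀ v, ∃ w, ∃ h : G.Adj v w, f ⟨s(v, w), h⟩ = 1 := by
    intro v
    have h2 : 0 < G.weightAt f v := by rw [hperf.weightAt_eq_one]; exact one_pos
    obtain ⟨⟨e, he⟩, hev, hpos⟩ := Finset.exists_lt_of_sum_lt (s := Finset.univ.filter
      fun e : G.edgeSet => v ∈ (e : Sym2 V)) (f := fun _ => (0 : ℝ)) (g := f)
      (by simpa [weightAt] using h2)
    simp only [Finset.mem_filter, Finset.mem_univ, true_and] at hev
    obtain ⟨w, rfl⟩ := hev
    exact ⟨w, he, (h01 _).resolve_left hpos.ne'⟩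
  choose ν hν hν1 using hex
  refine ⟨ν, fun v => ?_, hν, fun e he v hv => ?_⟩
  · have := congrArg Subtype.val
      (huniq _ _ (ν v) (hν1 v) (hν1 (ν v)) (Sym2.mem_mk_right _ _) (Sym2.mem_mk_left _ _))
    simp only [Sym2.eq_iff] at this
    rcases this with h | h
    · exact absurd h.1 (hν v).ne
    · exact h.1.symm
  · exact congrArg Subtype.val (huniq _ _ v he (hν1 v) hv (Sym2.mem_mk_left _ _))

end matchingWeight

end SimpleGraph

/-! ### Graphs with vertex-disjoint cycles. -/

namespace SimpleGraph

variable {V : Type*} {G : SimpleGraph V}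

theorem CyclesVertexDisjoint.toSubgraph_eq (h : G.CyclesVertexDisjoint) {u v x : V}
    {c : G.Walk u u} {d : G.Walk v v} (hc : c.IsCycle) (hd : d.IsCycle) (hxc : x ∈ c.support)
    (hxd : x ∈ d.support) : c.toSubgraph = d.toSubgraph :=
  by_contra fun hne => h c d hc hd hne x hxc hxd

theorem CyclesVertexDisjoint.mem_edges (h : G.CyclesVertexDisjoint) {u v x : V}
    {c : G.Walk u u} {d : G.Walk v v} (hc : c.IsCycle) (hd : d.IsCycle) (hxc : x ∈ c.support)
    (hxd : x ∈ d.support) {e : Sym2 V} (he : e ∈ d.edges) : e ∈ c.edges := by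
  rw [← Walk.mem_edges_toSubgraph] at he ⊢
  rwa [h.toSubgraph_eq hc hd hxc hxd]

/-- An edge joining two vertices that stay connected without it lies on every cycle through one
of its ends. -/
theorem CyclesVertexDisjoint.mem_edges_of_reachable (h : G.CyclesVertexDisjoint) {u v w : V}
    {c : G.Walk u u} (hc : c.IsCycle) (hv : v ∈ c.support) (hadj : G.Adj v w)
    (hr : (G.deleteEdges {s(v, w)}).Reachable v w) : s(v, w) ∈ c.edges := by
  obtain ⟨a, d, hd, he⟩ := adj_and_reachable_delete_edges_iff_exists_cycle.1 ⟨hadj, hr⟩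
  exact h.mem_edges hc hd hv (d.fst_mem_support_of_mem_edges he) he

/-- Cycles are induced subgraphs. -/
theorem CyclesVertexDisjoint.mem_edges_of_adj (h : G.CyclesVertexDisjoint) {u v w : V}
    {c : G.Walk u u} (hc : c.IsCycle) (hv : v ∈ c.support) (hw : w ∈ c.support)
    (hadj : G.Adj v w) : s(v, w) ∈ c.edges := by
  classical
  by_contra hne
  refine hne (h.mem_edges_of_reachable hc hv hadj ?_)
  have key : ∀ x ∈ c.support, (G.deleteEdges {s(v, w)}).Reachable u x := by
    intro x hx
    refine ⟨(c.takeUntil x hx).transfer _ fun e he => ?_⟩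
    have he' := Walk.edges_takeUntil_subset_edges c hx he
    rw [edgeSet_deleteEdges]
    refine ⟨c.edges_subset_edgeSet he', ?_⟩
    rintro rfl
    exact hne he'
  exact (key v hv).symm.trans (key w hw)

/-- A return walk of matched pairs closes up to a cycle with prescribed edges at `w`. -/
theorem exists_isCycle_of_reflTransGen {μ : V → V} (hμ : Function.Involutive μ)
    (hadj : ∀ v, G.Adj v (μ v)) (C : G.Coloring (Fin 2)) {w a : V} (hwa : G.Adj w (μ a))
    (hne : a ≠ w) (hr : Relation.ReflTransGen (fun x y => G.Adj x (μ y)) a w) :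
    ∃ c : G.Walk w w, c.IsCycle ∧ s(w, μ a) ∈ c.edges ∧
      ∀ y, s(w, y) ∈ c.edges → y = μ a ∨ y = μ w := by
  classical
  -- At `w` only the edge to `μ w` survives in `G'`, so a path from `μ a` back to `w` ends with that
  -- edge, and the edge from `w` to `μ a` closes it to a cycle.
  let G' : SimpleGraph V :=
    { Adj := fun x y => G.Adj x y ∧ (x = w → y = μ w) ∧ (y = w → x = μ w)
      symm := ⟨fun x y h => ⟨h.1.symm, h.2.2, h.2.1⟩⟩
      loopless := ⟨fun x h => h.1.ne rfl⟩ }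
  have hle : G' ≤ G := fun x y h => h.1
  have hC2 : ∀ x y, G.Adj x (μ y) → C x = C y := by
    intro x y h
    have h1 := C.valid h
    have h2 := C.valid (hadj y)
    omega
  have hpair : ∀ x, G'.Adj (μ x) x := by
    intro x
    refine ⟨(hadj x).symm, fun h => ?_, fun h => by rw [h]⟩
    rw [← h, hμ]
  -- The colour is carried along to exclude `μ y = w` in the inductive step.
  have key : C a = C w ∧ G'.Reachable (μ a) w := by
    clear hwa hne
    induction hr using Relation.ReflTransGen.head_induction_on with
    | refl => exact ⟨rfl, (hpair w).reachable⟩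
    | @head x y hxy _ ih =>
      have hCx : C x = C w := (hC2 x y hxy).trans ih.1
      refine ⟨hCx, ?_⟩
      by_cases hxw : x = w
      · rw [hxw]
        exact (hpair w).reachable
      · have hxy' : G'.Adj x (μ y) := by
          refine ⟨hxy, fun h => absurd h hxw, fun h => ?_⟩
          have := C.valid hxy
          rw [h] at this
          exact absurd hCx this
        exact (hpair x).reachable.trans (hxy'.reachable.trans ih.2)
  obtain ⟨p, hp⟩ := key.2.exists_isPath
  have hnot : s(w, μ a) ∉ p.edges := by
    intro h
    have h1 : G'.Adj w (μ a) := p.edges_subset_edgeSet h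
    exact hne (hμ.injective (h1.2.1 rfl))
  refine ⟨Walk.cons hwa (p.mapLe hle), ?_, by simp, ?_⟩
  · rw [Walk.cons_isCycle_iff]
    exact ⟨hp.mapLe hle, by simpa using hnot⟩
  · intro y hy
    simp only [Walk.edges_cons, List.mem_cons, Walk.edges_mapLe_eq_edges] at hy
    rcases hy with h | h
    · left
      grind
    · right
      have h1 : G'.Adj w y := p.edges_subset_edgeSet h
      exact h1.2.1 rfl

/-- If `π` left the cycle at `v`, alternating `π` and `μ` would lead from `π v` back to `v` without
reusing the edge `s(v, π v)`. That edge would then lie on a cycle through `v`, which can only be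
`c`. -/
theorem CyclesVertexDisjoint.perm_mem_support [Finite V] (h : G.CyclesVertexDisjoint)
    (C : G.Coloring (Fin 2)) {μ : V → V} (hμ : Function.Involutive μ) (hadj : ∀ v, G.Adj v (μ v))
    {u : V} {c : G.Walk u u} (hc : c.IsCycle) (hμc : ∀ v ∈ c.support, μ v ∈ c.support)
    {π : Equiv.Perm V} (hπ : ∀ v, G.Adj v (π v)) {v : V} (hv : v ∈ c.support) :
    π v ∈ c.support := by
  by_contra hπv
  refine hπv (c.snd_mem_support_of_mem_edges (h.mem_edges_of_reachable hc hv (hπ v) ?_))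
  have hμπ : μ (π v) ≠ v := by
    intro h
    have h1 := hμc v hv
    rw [← h, hμ] at h1
    exact hπv h1
  set σ : Equiv.Perm V := π.trans hμ.toPerm with hσ
  have hσa : ∀ x, σ x = μ (π x) := fun x => rfl
  have hCσ : ∀ x, C (σ x) = C x := by
    intro x
    have h1 := C.valid (hπ x)
    have h2 := C.valid (hadj (π x))
    rw [hσa]
    omega
  have hsnd : ∀ x, C x = C v →
      (G.deleteEdges {s(v, π v)}).Adj (π x) (σ x) := by
    intro x hx
    rw [deleteEdges_adj, hσa]
    refine ⟨hadj _, ?_⟩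
    rw [Set.mem_singleton_iff, Sym2.eq_iff]
    rintro (⟨h1, -⟩ | ⟨h1, h2⟩)
    · exact C.valid (hπ x) (hx.trans (congrArg C h1.symm))
    · rw [h1] at h2
      exact hμπ h2
  -- The walk stops at its first visit to `v`; before that, the colours and `hμπ` keep it off the
  -- deleted edge.
  have key : ∀ (j : ℕ) x, C x = C v → (σ ^ j) x = v →
      (G.deleteEdges {s(v, π v)}).Reachable x v := by
    intro j
    induction j with
    | zero => rintro x - rfl; exact Reachable.refl _
    | succ j ih =>
      intro x hx hj
      by_cases hxv : x = v
      · rw [hxv]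
      · have h1 : (G.deleteEdges {s(v, π v)}).Adj x (π x) := by
          rw [deleteEdges_adj]
          refine ⟨hπ x, ?_⟩
          rw [Set.mem_singleton_iff, Sym2.eq_iff]
          rintro (⟨h1, -⟩ | ⟨h1, -⟩)
          · exact hxv h1
          · rw [h1] at hx
            exact C.valid (hπ v) hx.symm
        exact h1.reachable.trans ((hsnd x hx).reachable.trans
          (ih (σ x) ((hCσ x).trans hx) (by rw [← hj, pow_succ]; rfl)))
  obtain ⟨n, hn⟩ : ∃ n, orderOf σ = n + 1 := Nat.exists_eq_succ_of_ne_zero (orderOf_pos σ).ne'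
  refine ((hsnd v rfl).reachable.trans (key n (σ v) (hCσ v) ?_)).symm
  have h1 : (σ ^ (n + 1)) v = v := by rw [← hn, pow_orderOf_eq_one]; rfl
  rw [pow_succ] at h1
  exact h1

end SimpleGraph

/-- Some strongly connected class reachable from `a` is terminal. -/
theorem Relation.exists_terminal {α : Type*} [Finite α] (r : α → α → Prop) (a : α) :
    ∃ b, ReflTransGen r a b ∧ ∀ c, ReflTransGen r b c → ReflTransGen r c b := by
  obtain ⟨b, hb, hmin⟩ := Set.exists_min_image {b | ReflTransGen r a b}
    (fun b => {c | ReflTransGen r b c}.ncard) (Set.toFinite _) ⟨a, ReflTransGen.refl⟩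
  refine ⟨b, hb, fun c hc => ?_⟩
  have hsub : {d | ReflTransGen r c d} ⊆ {d | ReflTransGen r b d} := fun d hd => hc.trans hd
  have := Set.eq_of_subset_of_ncard_le hsub (hmin c (hb.trans hc)) (Set.toFinite _)
  have hb' : b ∈ {d | ReflTransGen r b d} := ReflTransGen.refl
  rwa [← this] at hb'

/-! ### Matrix entries, walk weights and signatures. -/

namespace MixedGraph

variable {V : Type*} (M : MixedGraph V)

theorem hermitianAdjMatrix_eq_zero {u v : V} (h : ¬ M.graph.Adj u v) :
    M.hermitianAdjMatrix u v = 0 := by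
  have h1 : ¬ M.Arc u v := fun h' => h (M.adj_of_arc _ _ h')
  have h2 : ¬ M.Arc v u := fun h' => h (M.adj_of_arc _ _ h').symm
  simp [hermitianAdjMatrix, h, h1, h2]

theorem hermitianAdjMatrix_mul_symm {u v : V} (h : M.graph.Adj u v) :
    M.hermitianAdjMatrix u v * M.hermitianAdjMatrix v u = 1 := by
  have h1 := M.not_arc_of_arc u v
  by_cases huv : M.Arc u v
  · simp [hermitianAdjMatrix, huv, h1 huv]
  · by_cases hvu : M.Arc v u
    · simp [hermitianAdjMatrix, huv, hvu]
    · simp [hermitianAdjMatrix, huv, hvu, h, h.symm]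

theorem adj_of_hermitianAdjMatrix_ne_zero {u v : V} (h : M.hermitianAdjMatrix u v ≠ 0) :
    M.graph.Adj u v :=
  by_contra fun h' => h (M.hermitianAdjMatrix_eq_zero h')

theorem hermitianAdjMatrix_ne_zero {u v : V} (h : M.graph.Adj u v) :
    M.hermitianAdjMatrix u v ≠ 0 :=
  left_ne_zero_of_mul_eq_one (M.hermitianAdjMatrix_mul_symm h)

/-- The product of the matrix entries along a walk. -/
noncomputable def walkWeight {u v : V} (p : M.graph.Walk u v) : ℂ :=
  (p.darts.map fun d => M.hermitianAdjMatrix d.fst d.snd).prod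

open Classical in
theorem walkWeight_eq_I_zpow {u v : V} (p : M.graph.Walk u v) :
    M.walkWeight p = Complex.I ^ ((p.darts.countP fun d => M.Arc d.fst d.snd : ℤ) -
      (p.darts.countP fun d => M.Arc d.snd d.fst : ℤ)) := by
  unfold walkWeight
  induction p.darts with
  | nil => simp
  | cons d l ih =>
    rw [List.map_cons, List.prod_cons, ih, List.countP_cons, List.countP_cons]
    have h1 := M.not_arc_of_arc d.fst d.snd
    have hI := Complex.I_ne_zero
    by_cases huv : M.Arc d.fst d.snd
    · simp only [hermitianAdjMatrix, Matrix.of_apply, huv, h1 huv, decide_true, decide_false,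
        if_true]
      rw [← zpow_one_add₀ hI]
      congr 1
      push_cast
      simp
      ring
    · by_cases hvu : M.Arc d.snd d.fst
      · simp only [hermitianAdjMatrix, Matrix.of_apply, huv, hvu, decide_true, decide_false,
          if_true, if_false]
        rw [← Complex.inv_I, ← zpow_neg_one, ← zpow_add₀ hI]
        congr 1
        push_cast
        simp
        ring
      · simp [hermitianAdjMatrix, huv, hvu]

/-- The absolute value is harmless because an even length is congruent to its negative mod 4; the
rest is that `I` has order 4. -/
theorem signature_modEq_iff {u : V} {c : M.graph.Walk u u} (hc : Even c.length) :
    M.signature c ≡ c.length [MOD 4] ↔ M.walkWeight c = Complex.I ^ c.length := by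
  rw [walkWeight_eq_I_zpow, ← zpow_natCast, ← sub_eq_zero, signature]
  generalize (_ - _ : ℤ) = z
  obtain ⟨k, hk⟩ := hc
  have h1 : z.natAbs ≡ c.length [MOD 4] ↔ ((4 : ℕ) : ℤ) ∣ z - c.length := by
    unfold Nat.ModEq
    omega
  rw [h1, ← Complex.isPrimitiveRoot_I.zpow_eq_one_iff_dvd, zpow_sub₀ Complex.I_ne_zero,
    sub_eq_zero, div_eq_one_iff_eq (zpow_ne_zero _ Complex.I_ne_zero)]

theorem walkWeight_eq_prod_range {u v : V} (p : M.graph.Walk u v) :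
    M.walkWeight p =
      ∏ i ∈ Finset.range p.length, M.hermitianAdjMatrix (p.getVert i) (p.getVert (i + 1)) := by
  induction p with
  | nil => simp [walkWeight]
  | cons h p ih =>
    rw [SimpleGraph.Walk.length_cons, Finset.prod_range_succ']
    simp only [SimpleGraph.Walk.getVert_cons_succ, SimpleGraph.Walk.getVert_zero]
    rw [← ih]
    simp [walkWeight, mul_comm]

/-- Propagating a value around the cycle is consistent: one full turn multiplies it by `I ^
c.length` over the weight of `c`, which is 1. -/
theorem exists_potential {u : V} {c : M.graph.Walk u u} (hc : c.IsCycle)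
    (hw : M.walkWeight c = Complex.I ^ c.length) :
    ∃ θ : V → ℂ, θ u = 1 ∧ (∀ y, y ∉ c.support → θ y = 0) ∧
      ∀ j < c.length, θ (c.getVert (j + 1)) =
        Complex.I * M.hermitianAdjMatrix (c.getVert (j + 1)) (c.getVert j) * θ (c.getVert j) := by
  classical
  set t : ℕ → ℂ := fun j => ∏ i ∈ Finset.range j,
    (Complex.I * M.hermitianAdjMatrix (c.getVert (i + 1)) (c.getVert i)) with ht
  have htq : t c.length = 1 := by
    rw [ht]
    simp only
    rw [Finset.prod_mul_distrib, Finset.prod_const, Finset.card_range, ← hw,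
      walkWeight_eq_prod_range, ← Finset.prod_mul_distrib]
    refine Finset.prod_eq_one fun i hi => ?_
    exact M.hermitianAdjMatrix_mul_symm (c.adj_getVert_succ (Finset.mem_range.1 hi))
  have h3 := hc.three_le_length
  let θ : V → ℂ := fun y => if h : ∃ j < c.length, c.getVert j = y then t h.choose else 0
  have hlt : ∀ j < c.length, θ (c.getVert j) = t j := by
    intro j hj
    have hex : ∃ i < c.length, c.getVert i = c.getVert j := ⟨j, hj, rfl⟩
    simp only [θ]
    rw [dif_pos hex]
    congr 1
    refine hc.getVert_injOn' ?_ ?_ hex.choose_spec.2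
    · have := hex.choose_spec.1
      simp only [Set.mem_ofPred_eq]
      omega
    · simp only [Set.mem_ofPred_eq]
      omega
  have hle : ∀ j ≤ c.length, θ (c.getVert j) = t j := by
    intro j hj
    rcases hj.lt_or_eq with h | rfl
    · exact hlt j h
    · have := hlt 0 (by omega)
      rw [SimpleGraph.Walk.getVert_zero] at this
      rw [SimpleGraph.Walk.getVert_length, this, htq]
      simp [ht]
  refine ⟨θ, ?_, ?_, ?_⟩
  · have := hlt 0 (by omega)
    rw [SimpleGraph.Walk.getVert_zero] at this
    rw [this]
    simp [ht]
  · intro y hy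
    refine dif_neg ?_
    rintro ⟨j, -, rfl⟩
    exact hy (c.getVert_mem_support j)
  · intro j hj
    rw [hle _ hj, hle _ hj.le, ht]
    simp only
    rw [Finset.prod_range_succ, mul_comm]

/-! ### A bad cycle closed under the matching makes the determinant vanish. -/

variable [Fintype V]

/-- A cycle whose signature is congruent to its length has a singular adjacency matrix. -/
theorem exists_cycle_kernel (hdisj : M.graph.CyclesVertexDisjoint) {u : V}
    {c : M.graph.Walk u u} (hc : c.IsCycle) (hw : M.walkWeight c = Complex.I ^ c.length) :
    ∃ θ : V → ℂ, θ u = 1 ∧ (∀ y, y ∉ c.support → θ y = 0) ∧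
      ∀ v ∈ c.support, ∑ y, M.hermitianAdjMatrix v y * θ y = 0 := by
  classical
  obtain ⟨θ, hθu, hθ0, hθ⟩ := M.exists_potential hc hw
  refine ⟨θ, hθu, hθ0, fun v hv => ?_⟩
  have h3 := hc.three_le_length
  obtain ⟨a, b, hab, hN, ha, hb⟩ : ∃ a b, a ≠ b ∧ c.toSubgraph.neighborSet v = {a, b} ∧
      θ v = Complex.I * M.hermitianAdjMatrix v a * θ a ∧
      θ b = Complex.I * M.hermitianAdjMatrix b v * θ v := by
    obtain ⟨i, rfl, hi⟩ := SimpleGraph.Walk.mem_support_iff_exists_getVert.1 hv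
    by_cases h0 : i = 0 ∨ i = c.length
    · have hiu : c.getVert i = u := by
        rcases h0 with rfl | rfl <;> simp
      rw [hiu]
      refine ⟨c.penultimate, c.snd, hc.snd_ne_penultimate.symm, ?_, ?_, ?_⟩
      · rw [hc.neighborSet_toSubgraph_endpoint, Set.pair_comm]
      · have := hθ (c.length - 1) (by omega)
        rw [Nat.sub_add_cancel (by omega), SimpleGraph.Walk.getVert_length] at this
        exact this
      · have := hθ 0 (by omega)
        rw [SimpleGraph.Walk.getVert_zero] at this
        exact this
    · push Not at h0
      refine ⟨c.getVert (i - 1), c.getVert (i + 1),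
        hc.getVert_sub_one_ne_getVert_add_one (by omega),
        hc.neighborSet_toSubgraph_internal h0.1 (by omega), ?_, hθ i (by omega)⟩
      have := hθ (i - 1) (by omega)
      rwa [Nat.sub_add_cancel (by omega)] at this
  have hbv : M.graph.Adj v b := by
    have : b ∈ c.toSubgraph.neighborSet v := by rw [hN]; simp
    exact c.toSubgraph.adj_sub this
  -- The predecessor `a` contributes `-I * θ v` and the successor `b` contributes `I * θ v`. Other
  -- neighbours lie off the cycle, since it has no chords.
  rw [← Finset.sum_subset (Finset.subset_univ {a, b}), Finset.sum_pair hab]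
  · have h1 := M.hermitianAdjMatrix_mul_symm hbv
    have h2 := Complex.I_mul_I
    rw [hb]
    linear_combination (Complex.I * θ v) * h1 + Complex.I * ha
      + (M.hermitianAdjMatrix v a * θ a) * h2
  · intro y _ hy
    by_cases hys : y ∈ c.support
    · rw [M.hermitianAdjMatrix_eq_zero, zero_mul]
      intro hvy
      have h1 : y ∈ c.toSubgraph.neighborSet v := by
        rw [SimpleGraph.Subgraph.mem_neighborSet, ← SimpleGraph.Subgraph.mem_edgeSet,
          SimpleGraph.Walk.mem_edges_toSubgraph]
        exact hdisj.mem_edges_of_adj hc hv hys hvy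
      rw [hN] at h1
      exact hy (by simpa using h1)
    · rw [hθ0 y hys, mul_zero]

variable [DecidableEq V]

theorem Nonsingular.exists_perm {M : MixedGraph V} (h : M.Nonsingular) :
    ∃ π : Equiv.Perm V, ∀ v, M.graph.Adj v (π v) := by
  by_contra! hno
  refine h ?_
  rw [Matrix.det_apply]
  refine Finset.sum_eq_zero fun π _ => ?_
  obtain ⟨v, hv⟩ := hno π
  rw [Finset.prod_eq_zero (f := fun i => M.hermitianAdjMatrix (π i) i) (Finset.mem_univ v)
    (M.hermitianAdjMatrix_eq_zero fun h' => hv h'.symm), smul_zero]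

/-- `θ` annihilates only the rows on the cycle. Zeroing the entries that join the cycle to its
complement makes it a kernel vector, and no nonzero term of the determinant uses such an entry. -/
theorem det_eq_zero_of_cycle (hdisj : M.graph.CyclesVertexDisjoint)
    (C : M.graph.Coloring (Fin 2)) {μ : V → V} (hμ : Function.Involutive μ)
    (hadj : ∀ v, M.graph.Adj v (μ v)) {u : V} {c : M.graph.Walk u u} (hc : c.IsCycle)
    (hμc : ∀ v ∈ c.support, μ v ∈ c.support)
    (hw : M.walkWeight c = Complex.I ^ c.length) : M.hermitianAdjMatrix.det = 0 := by
  obtain ⟨θ, hθu, hθ0, hθ⟩ := M.exists_cycle_kernel hdisj hc hw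
  set H' : Matrix V V ℂ := Matrix.of fun x y =>
    if (x ∈ c.support ↔ y ∈ c.support) then M.hermitianAdjMatrix x y else 0 with hH'
  have hdet : M.hermitianAdjMatrix.det = H'.det := by
    rw [Matrix.det_apply, Matrix.det_apply]
    refine Finset.sum_congr rfl fun π _ => ?_
    congr 1
    by_cases hπ : ∀ v, M.graph.Adj v (π v)
    · refine Finset.prod_congr rfl fun v _ => ?_
      rw [hH', Matrix.of_apply, if_pos]
      refine ⟨fun h => ?_, fun h => hdisj.perm_mem_support C hμ hadj hc hμc hπ h⟩
      have hπ' : ∀ v, M.graph.Adj v (π⁻¹ v) := fun v => by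
        have := (hπ (π⁻¹ v)).symm
        simpa using this
      simpa using hdisj.perm_mem_support C hμ hadj hc hμc hπ' h
    · push Not at hπ
      obtain ⟨v, hv⟩ := hπ
      have h0 : M.hermitianAdjMatrix (π v) v = 0 :=
        M.hermitianAdjMatrix_eq_zero fun h' => hv h'.symm
      have h0' : H' (π v) v = 0 := by simp [hH', h0]
      rw [Finset.prod_eq_zero (f := fun i => M.hermitianAdjMatrix (π i) i) (Finset.mem_univ v) h0,
        Finset.prod_eq_zero (f := fun i => H' (π i) i) (Finset.mem_univ v) h0']
  rw [hdet]
  refine Matrix.exists_mulVec_eq_zero_iff.1 ⟨θ, fun h => ?_, ?_⟩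
  · rw [h] at hθu
    simp at hθu
  · ext v
    simp only [Matrix.mulVec, dotProduct, Pi.zero_apply]
    by_cases hv : v ∈ c.support
    · rw [← hθ v hv]
      refine Finset.sum_congr rfl fun y _ => ?_
      by_cases hy : y ∈ c.support
      · simp [hH', hv, hy]
      · simp [hθ0 y hy]
    · refine Finset.sum_eq_zero fun y _ => ?_
      by_cases hy : y ∈ c.support
      · simp [hH', hv, hy]
      · simp [hθ0 y hy]

end MixedGraph

/-! ### From a kernel vector to a bad cycle closed under the matching. -/

theorem SimpleGraph.Walk.isCycle_of_support_tail_nodup {V : Type*} {G : SimpleGraph V} {u : V}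
    {p : G.Walk u u} (hp : p.support.tail.Nodup) (hl : 3 ≤ p.length) : p.IsCycle := by
  cases p with
  | nil => simp at hl
  | @cons _ v _ h q =>
    rw [SimpleGraph.Walk.support_cons, List.tail_cons] at hp
    rw [SimpleGraph.Walk.cons_isCycle_iff, SimpleGraph.Walk.isPath_def]
    refine ⟨hp, fun he => ?_⟩
    cases q with
    | nil => simp at he
    | @cons _ w _ h' q =>
      rw [SimpleGraph.Walk.support_cons, List.nodup_cons] at hp
      rw [SimpleGraph.Walk.edges_cons, List.mem_cons] at he
      rcases he with he | he
      · have hw : u = w := by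
          have := h.ne
          grind
        subst hw
        have := SimpleGraph.Walk.isPath_iff_nil.1 ((SimpleGraph.Walk.isPath_def q).2 hp.2)
        simp [SimpleGraph.Walk.length_eq_zero_iff.2 this] at hl
      · exact hp.1 (q.snd_mem_support_of_mem_edges he)

namespace MixedGraph

variable {V : Type*} (M : MixedGraph V)

/-- The walk `w, μ (g w), g w, μ (g (g w)), …` and its weight in terms of a potential `φ`. -/
theorem exists_alternating_walk {μ g : V → V} (hμ : Function.Involutive μ)
    (hadj : ∀ v, M.graph.Adj v (μ v)) (C : M.graph.Coloring (Fin 2)) {P : V → Prop}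
    (hP : ∀ w, P w → P (g w)) (hg : ∀ w, P w → M.graph.Adj w (μ (g w))) {φ : V → ℂ}
    (hφ : ∀ w, P w → M.hermitianAdjMatrix w (μ (g w)) * M.hermitianAdjMatrix (μ (g w)) (g w) *
      φ (g w) = -φ w) (n : ℕ) :
    ∀ w, P w → (∀ i < n, ∀ j < n, g^[i] (g w) = g^[j] (g w) → i = j) →
      ∃ p : M.graph.Walk w (g^[n] w), p.length = 2 * n ∧ p.support.tail.Nodup ∧
        (∀ y, y ∈ p.support.tail ↔ ∃ j < n, y = g^[j] (g w) ∨ y = μ (g^[j] (g w))) ∧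
        M.walkWeight p * φ (g^[n] w) = (-1) ^ n * φ w := by
  have hC : ∀ w, P w → C (g w) = C w := by
    intro w hw
    have h1 := C.valid (hg w hw)
    have h2 := C.valid (hadj (g w))
    omega
  have hCn : ∀ j w, P w → C (g^[j] w) = C w := by
    intro j
    induction j with
    | zero => intro w _; rfl
    | succ j ih => intro w hw; exact (ih _ (hP w hw)).trans (hC w hw)
  induction n with
  | zero =>
    intro w _ _
    exact ⟨SimpleGraph.Walk.nil, by simp, by simp, by simp, by simp [walkWeight]⟩
  | succ n ih =>
    intro w hw hinj
    rw [Function.iterate_succ_apply]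
    obtain ⟨p, hl, hnd, hmem, hwt⟩ := ih (g w) (hP w hw) fun i hi j hj h => by
      have := hinj (i + 1) (by omega) (j + 1) (by omega) h
      omega
    have htail : (SimpleGraph.Walk.cons (hg w hw)
        (SimpleGraph.Walk.cons (hadj (g w)).symm p)).support.tail =
          μ (g w) :: g w :: p.support.tail := by
      rw [SimpleGraph.Walk.support_cons, List.tail_cons, SimpleGraph.Walk.support_cons]
      congr 1
      exact p.cons_tail_support.symm
    refine ⟨SimpleGraph.Walk.cons (hg w hw) (SimpleGraph.Walk.cons (hadj (g w)).symm p),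
      ?_, ?_, ?_, ?_⟩
    · simp only [SimpleGraph.Walk.length_cons, hl]
      ring
    -- All iterates of `g` share one colour and their partners have the other, so only repetitions
    -- among iterates need excluding.
    · have hcol : ∀ j, C (g^[j] (g (g w))) = C (g w) := fun j =>
        hCn (j + 1) (g w) (hP w hw)
      have hne : ∀ j < n, g w ≠ g^[j] (g (g w)) := fun j hj h => by
        have := hinj 0 (by omega) (j + 1) (by omega) h
        omega
      rw [htail, List.nodup_cons, List.nodup_cons, List.mem_cons, hmem, hmem]
      refine ⟨?_, ?_, hnd⟩
      · rintro (h | ⟨j, hj, h | h⟩)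
        · exact (hadj (g w)).ne h.symm
        · exact C.valid (hadj (g w)) ((hcol j).symm.trans (congrArg C h.symm))
        · exact hne j hj (hμ.injective h)
      · rintro ⟨j, hj, h | h⟩
        · exact hne j hj h
        · refine C.valid (hadj (g^[j] (g (g w)))) ((hcol j).trans (congrArg C h))
    · intro y
      rw [htail, List.mem_cons, List.mem_cons, hmem]
      constructor
      · rintro (rfl | rfl | ⟨j, hj, h⟩)
        · exact ⟨0, by omega, Or.inr rfl⟩
        · exact ⟨0, by omega, Or.inl rfl⟩
        · exact ⟨j + 1, by omega, h⟩
      · rintro ⟨j, hj, h⟩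
        rcases j with _ | j
        · rcases h with h | h
          · exact Or.inr (Or.inl h)
          · exact Or.inl h
        · exact Or.inr (Or.inr ⟨j, by omega, h⟩)
    · have h1 : M.walkWeight (SimpleGraph.Walk.cons (hg w hw)
          (SimpleGraph.Walk.cons (hadj (g w)).symm p)) = M.hermitianAdjMatrix w (μ (g w)) *
            (M.hermitianAdjMatrix (μ (g w)) (g w) * M.walkWeight p) := by
        simp [walkWeight]
      rw [h1, pow_succ]
      linear_combination M.hermitianAdjMatrix w (μ (g w)) *
        M.hermitianAdjMatrix (μ (g w)) (g w) * hwt + (-1) ^ n * hφ w hw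

variable [Fintype V] [DecidableEq V]

theorem exists_cycle_of_det_eq_zero (hdisj : M.graph.CyclesVertexDisjoint)
    (C : M.graph.Coloring (Fin 2)) {μ : V → V} (hμ : Function.Involutive μ)
    (hadj : ∀ v, M.graph.Adj v (μ v)) (hdet : M.hermitianAdjMatrix.det = 0) :
    ∃ (u : V) (c : M.graph.Walk u u), c.IsCycle ∧ Even c.length ∧
      M.walkWeight c = Complex.I ^ c.length ∧ ∀ v ∈ c.support, μ v ∈ c.support := by
  obtain ⟨x, hx0, hx⟩ := Matrix.exists_mulVec_eq_zero_iff.2 hdet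
  have hrow : ∀ v, ∑ y, M.hermitianAdjMatrix v y * x y = 0 := fun v => congrFun hx v
  let r : V → V → Prop := fun a b => M.graph.Adj a (μ b) ∧ a ≠ b ∧ x (μ b) ≠ 0
  have hsucc : ∀ a, x (μ a) ≠ 0 → ∃ b, r a b := by
    intro a ha
    by_contra! hno
    have h1 := hrow a
    rw [Finset.sum_eq_single (μ a)] at h1
    · exact mul_ne_zero (M.hermitianAdjMatrix_ne_zero (hadj a)) ha h1
    · intro y _ hy
      by_contra hne
      refine hno (μ y) ⟨?_, fun h => hy ?_, ?_⟩
      · rw [hμ]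
        exact M.adj_of_hermitianAdjMatrix_ne_zero (left_ne_zero_of_mul hne)
      · rw [h, hμ]
      · rw [hμ]
        exact right_ne_zero_of_mul hne
    · intro h
      exact absurd (Finset.mem_univ _) h
  obtain ⟨v, hv⟩ := Function.ne_iff.1 hx0
  -- Starting from `μ v` gives `x (μ (μ v)) = x v ≠ 0`; later vertices inherit this from the last
  -- clause of `r`.
  obtain ⟨b, hab, hb⟩ := Relation.exists_terminal r (μ v)
  have hxR : ∀ w, Relation.ReflTransGen r (μ v) w → x (μ w) ≠ 0 := by
    intro w hw
    rcases Relation.ReflTransGen.cases_tail hw with h | ⟨c, -, hc⟩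
    · rw [h, hμ]
      exact hv
    · exact hc.2.2
  replace hxR : ∀ w, Relation.ReflTransGen r b w → x (μ w) ≠ 0 :=
    fun w hw => hxR w (hab.trans hw)
  have hcycle : ∀ w a, Relation.ReflTransGen r b w → r w a → ∃ c : M.graph.Walk w w, c.IsCycle ∧
      s(w, μ a) ∈ c.edges ∧ ∀ y, s(w, y) ∈ c.edges → y = μ a ∨ y = μ w := by
    intro w a hw ha
    refine SimpleGraph.exists_isCycle_of_reflTransGen hμ hadj C ha.1 ha.2.1.symm ?_
    have hr : Relation.ReflTransGen r a w := (hb a (hw.tail ha)).trans hw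
    exact hr.lift id fun _ _ h => h.1
  -- Two arrows out of `w` would give two cycles through `w`; they have the same edges, and at `w`
  -- these go only to `μ a` and `μ w`.
  have huniq : ∀ w a a', Relation.ReflTransGen r b w → r w a → r w a' → a' = a := by
    intro w a a' hw ha ha'
    obtain ⟨c, hc, -, hc2⟩ := hcycle w a hw ha
    obtain ⟨d, hd, hd1, -⟩ := hcycle w a' hw ha'
    rcases hc2 _ (hdisj.mem_edges hc hd c.start_mem_support d.start_mem_support hd1) with h | h
    · exact hμ.injective h
    · exact absurd (hμ.injective h).symm ha'.2.1
  have hex : ∀ w, ∃ a, Relation.ReflTransGen r b w → r w a := by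
    intro w
    by_cases hw : Relation.ReflTransGen r b w
    · obtain ⟨a, ha⟩ := hsucc w (hxR w hw)
      exact ⟨a, fun _ => ha⟩
    · exact ⟨w, fun h => absurd h hw⟩
  choose g hg using hex
  have hP : ∀ w, Relation.ReflTransGen r b w → Relation.ReflTransGen r b (g w) :=
    fun w hw => hw.tail (hg w hw)
  have hrel : ∀ w, Relation.ReflTransGen r b w → M.hermitianAdjMatrix w (μ w) * x (μ w) +
      M.hermitianAdjMatrix w (μ (g w)) * x (μ (g w)) = 0 := by
    intro w hw
    rw [← hrow w, ← Finset.sum_pair (f := fun y => M.hermitianAdjMatrix w y * x y)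
      (fun h => (hg w hw).2.1 (hμ.injective h))]
    refine Finset.sum_subset (Finset.subset_univ _) fun y _ hy => ?_
    by_contra hne
    simp only [Finset.mem_insert, Finset.mem_singleton, not_or] at hy
    have hry : r w (μ y) := by
      refine ⟨?_, fun h => hy.1 ?_, ?_⟩
      · rw [hμ]
        exact M.adj_of_hermitianAdjMatrix_ne_zero (left_ne_zero_of_mul hne)
      · rw [h, hμ]
      · rw [hμ]
        exact right_ne_zero_of_mul hne
    refine hy.2 ?_
    rw [← huniq w _ _ hw (hg w hw) hry, hμ]
  have hiter : ∀ w a, Relation.ReflTransGen r b w → Relation.ReflTransGen r w a →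
      ∃ n, g^[n] w = a := by
    intro w a hw hwa
    induction hwa with
    | refl => exact ⟨0, rfl⟩
    | tail h1 h2 ih =>
      obtain ⟨n, hn⟩ := ih
      refine ⟨n + 1, ?_⟩
      rw [Function.iterate_succ_apply', hn]
      exact (huniq _ _ _ (hw.trans h1) h2 (hg _ (hw.trans h1)))
  obtain ⟨n, hn⟩ := hiter (g b) b (hP b .refl) (hb _ (hP b .refl))
  have hper : b ∈ Function.periodicPts g := ⟨n + 1, n.succ_pos, hn⟩
  set k := Function.minimalPeriod g b with hk
  have hkb : g^[k] b = b := Function.iterate_minimalPeriod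
  have hkpos : 0 < k := Function.minimalPeriod_pos_of_mem_periodicPts hper
  -- Period at least 2 makes the alternating walk of length `2 * k` long enough to be a cycle.
  have hk1 : k ≠ 1 := by
    intro h
    rw [h] at hkb
    exact (hg b Relation.ReflTransGen.refl).2.1 hkb.symm
  have hinj : ∀ i < k, ∀ j < k, g^[i] (g b) = g^[j] (g b) → i = j := by
    have := Function.iterate_injOn_Iio_minimalPeriod (f := g) (x := g b)
    rw [Function.minimalPeriod_apply hper] at this
    exact fun i hi j hj h => this hi hj h
  -- The matched term of row `w`. Each double step of the walk changes the sign, so the closed walk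
  -- has weight `(-1) ^ k = I ^ (2 * k)`.
  set φ : V → ℂ := fun w => M.hermitianAdjMatrix w (μ w) * x (μ w) with hφd
  have hφ : ∀ w, Relation.ReflTransGen r b w → M.hermitianAdjMatrix w (μ (g w)) *
      M.hermitianAdjMatrix (μ (g w)) (g w) * φ (g w) = -φ w := by
    intro w hw
    have h1 := M.hermitianAdjMatrix_mul_symm (hadj (g w))
    have h2 := hrel w hw
    simp only [hφd]
    linear_combination h2 + M.hermitianAdjMatrix w (μ (g w)) * x (μ (g w)) * h1
  obtain ⟨p, hl, hnd, hmem, hwt⟩ := M.exists_alternating_walk hμ hadj C hP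
    (fun w hw => (hg w hw).1) hφ k b Relation.ReflTransGen.refl hinj
  have hφb : φ b ≠ 0 :=
    mul_ne_zero (M.hermitianAdjMatrix_ne_zero (hadj b)) (hxR b Relation.ReflTransGen.refl)
  revert p
  rw [hkb]
  intro p hl hnd hmem hwt
  have hmem' : ∀ y, y ∈ p.support ↔ ∃ j < k, y = g^[j] (g b) ∨ y = μ (g^[j] (g b)) := by
    intro y
    rw [← hmem, ← p.cons_tail_support, List.mem_cons, List.tail_cons]
    refine or_iff_right_of_imp ?_
    rintro rfl
    refine (hmem _).2 ⟨k - 1, by omega, Or.inl ?_⟩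
    rw [← Function.iterate_succ_apply, Nat.succ_eq_add_one, Nat.sub_add_cancel hkpos, hkb]
  refine ⟨b, p, SimpleGraph.Walk.isCycle_of_support_tail_nodup hnd (by omega),
    ⟨k, by omega⟩, ?_, ?_⟩
  · rw [hl, pow_mul, Complex.I_sq]
    exact mul_right_cancel₀ hφb hwt
  · intro y hy
    obtain ⟨j, hj, h | h⟩ := (hmem' y).1 hy
    · exact (hmem' _).2 ⟨j, hj, Or.inr (congrArg μ h)⟩
    · exact (hmem' _).2 ⟨j, hj, Or.inl (by rw [h, hμ])⟩

end MixedGraph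

theorem theorem1p5 {V : Type*} [Fintype V] [DecidableEq V] (M : MixedGraph V)
    (hbip : M.graph.IsBipartite) (hdisj : M.graph.CyclesVertexDisjoint) :
    M.Nonsingular ↔
      (∃ f : M.graph.edgeSet → ℝ, M.graph.IsFractionalPerfectMatching f) ∧
      (∃ f : M.graph.edgeSet → ℝ, M.graph.IsOptimalFractionalMatching f ∧
        ∀ (u : V) (c : M.graph.Walk u u), c.IsCycle → Even c.length →
          M.signature c ≡ c.length [MOD 4] →
            ∃ e ∈ M.graph.edgesLeaving {x | x ∈ c.support}, f e = 1) := by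
  obtain ⟨C⟩ := id hbip
  constructor
  · intro h
    obtain ⟨π, hπ⟩ := h.exists_perm
    obtain ⟨μ, hμ, hadj⟩ := hbip.exists_involutive hπ
    refine ⟨⟨_, SimpleGraph.isFractionalPerfectMatching_matchingWeight hμ hadj⟩,
      ⟨_, SimpleGraph.isOptimalFractionalMatching_matchingWeight hμ hadj,
        fun u c hc heven hsig => ?_⟩⟩
    by_contra! hno
    refine h (M.det_eq_zero_of_cycle hdisj C hμ hadj hc (fun v hv => ?_)
      ((M.signature_modEq_iff heven).1 hsig))
    by_contra hv'
    refine hno ⟨s(v, μ v), hadj v⟩ ⟨⟨v, Sym2.mem_mk_left _ _, hv⟩, μ v,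
      Sym2.mem_mk_right _ _, hv'⟩ (SimpleGraph.matchingWeight_eq_one_iff.2 ⟨v, rfl⟩)
  · rintro ⟨⟨f₀, hf₀⟩, f, hf, hleave⟩ hdet
    obtain ⟨π, hπ⟩ := hf₀.exists_perm
    obtain ⟨μ₀, hμ₀, hadj₀⟩ := hbip.exists_involutive hπ
    -- `μ₀` only certifies that a perfect matching exists; the cycle must be closed under the
    -- matching read off from the given `f`.
    obtain ⟨μ, hμ, hadj, hfμ⟩ := hf.exists_involutive hμ₀ hadj₀
    obtain ⟨u, c, hc, heven, hw, hμc⟩ :=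
      M.exists_cycle_of_det_eq_zero hdisj C hμ hadj hdet
    obtain ⟨e, ⟨⟨v, hve, hv⟩, y, hye, hy⟩, he⟩ :=
      hleave u c hc heven ((M.signature_modEq_iff heven).2 hw)
    rw [hfμ e he v hve, Sym2.mem_iff] at hye
    rcases hye with rfl | rfl
    · exact hy hv
    · exact hy (hμc v hv)
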